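/- Let $\xi$ be an (almost surely) positive real random variable. For each $n\ge 1$ let $A_n$ be an $n\times n$ random matrix whose entries are independent and identically distributed as $\xi$, with all the matrices $A_n$ defined on a common probability space (no assumption is made on the joint distribution of different $A_n$). Let $0<\alpha<1$. For a $k\times k$ matrix $B=(b_{ij})$ write $\operatorname{perm} B=\sum_{\pi\in S_k}\prod_{i=1}^k b_{i\pi(i)}$. A $k\times k$ submatrix of $A_n=(a_{ij})$ is a matrix $(a_{ij})_{i\in I,\,j\in J}$ with $I,J\subset\{1,\dots,n\}$ and $|I|=|J|=k$. Then: (i) Almost surely $$\liminf_{n\to\infty}\ \min_{(k,B)}\ \frac{\log \operatorname{perm} B}{k\log k}\ \ge\ 1,$$ where the minimum is taken over all integers $\alpha n\le k\le n$ and all $k\times k$ submatrices $B$ of $A_n$. (ii) If $\xi$ has finite mean, then almost surely $$\limsup_{n\to\infty}\ \max_{(k,B)}\ \frac{\log \operatorname{perm} B}{k\log k}\ =\ 1,$$ where the maximum is taken over all integers $\alpha n\le k\le n$ and all $k\times k$ submatrices $B$ of $A_n$. -/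

import Mathlib

open MeasureTheory ProbabilityTheory Filter

/-- The `k × k` submatrices `(a i j)_{i ∈ I, j ∈ J}` of an `n × n` matrix. A set of `k` row indices
(or of `k` column indices) is the range of exactly one order embedding `Fin k ↪o Fin n`. -/
def squareSubmatrices {n : ℕ} (A : Matrix (Fin n) (Fin n) ℝ) (k : ℕ) :
    Set (Matrix (Fin k) (Fin k) ℝ) :=
  {B | ∃ I J : Fin k ↪o Fin n, B = A.submatrix I J}

/-- The normalized logarithm `log (perm B) / (k log k)` of the permanent of a `k × k` matrix. -/
noncomputable def normLogPerm {k : ℕ} (B : Matrix (Fin k) (Fin k) ℝ) : ℝ :=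
  Real.log B.permanent / ((k : ℝ) * Real.log (k : ℝ))

/-- The minimum of `normLogPerm B` over all integers `α n ≤ k ≤ n` and all `k × k` submatrices `B`
of `A`. For `α ≤ 1` the family is finite and non-empty (take `k = n`), so that this infimum is
attained; it is taken in the extended reals. -/
noncomputable def minNormLogPerm (α : ℝ) {n : ℕ} (A : Matrix (Fin n) (Fin n) ℝ) : EReal :=
  ⨅ (k : ℕ) (_ : α * (n : ℝ) ≤ (k : ℝ) ∧ k ≤ n) (B ∈ squareSubmatrices A k),
    ((normLogPerm B : ℝ) : EReal)

/-- The maximum of `normLogPerm B` over all integers `α n ≤ k ≤ n` and all `k × k` submatrices `B`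
of `A`, as an attained supremum in the extended reals. -/
noncomputable def maxNormLogPerm (α : ℝ) {n : ℕ} (A : Matrix (Fin n) (Fin n) ℝ) : EReal :=
  ⨆ (k : ℕ) (_ : α * (n : ℝ) ≤ (k : ℝ) ∧ k ≤ n) (B ∈ squareSubmatrices A k),
    ((normLogPerm B : ℝ) : EReal)

/-!
The lower bound needs no moments. Given a small `β > 0`, choose `δ > 0` such that an entry is below
`δ` with tiny probability. A union bound over the sets of small entries in a line and the
Borel-Cantelli lemma show that almost surely, for large `n`, every row and column of `A n` has at
most `β n` entries below `δ` (`exists_pos_ae_eventually_card_lt_le`). This property passes to all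
submatrices of order `k ≥ α n`, with `z = ⌊β n⌋` a small fraction of `k`, so there is no need for a
union bound over submatrices. A nonnegative matrix of order `k ≥ 2 z` with at most `z` entries below
`δ` in each line has permanent at least `δ ^ k (k - 2 z)!`: expand along a column, where at least
`k - z` of the entries are at least `δ`, until the order is `2 z`, and then use Hall's marriage
theorem (`pow_mul_factorial_le_permanent`). The factorial gives `log perm B ≥ c k log k - O(k)` with
`c = 1 - 2 β / α` as close to `1` as desired.

For the upper bound, the expected permanent of a submatrix of order `k` is `k! m ^ k` with `m` the
mean of `ξ`. By Markov's inequality `perm B` exceeds `k! D ^ k` with probability at most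
`(m / D) ^ k`. For `D` large this beats the at most `(n + 1) 4 ^ n` submatrices, so that almost
surely `log perm B ≤ k log k + O(k)` for all of them once `n` is large
(`exists_pos_ae_eventually_permanent_lt`). The limit superior is also at least `1`, because the
maximum dominates the minimum.
-/

open scoped ENNReal

/-! ### Permanents of nonnegative matrices with few small entries in each line -/

theorem Matrix.permanent_succ_column_zero {n : ℕ} {R : Type*} [CommSemiring R]
    (M : Matrix (Fin (n + 1)) (Fin (n + 1)) R) :
    M.permanent = ∑ p, M p 0 *
      (M.submatrix (fun i : Fin n => Equiv.swap 0 p i.succ) Fin.succ).permanent := by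
  simp only [Matrix.permanent, Finset.mul_sum, Matrix.submatrix_apply]
  rw [← Equiv.Perm.decomposeFin.symm.sum_comp, Fintype.sum_prod_type]
  refine Finset.sum_congr rfl fun p _ => Finset.sum_congr rfl fun e _ => ?_
  rw [Fin.prod_univ_succ]
  simp

/-- If at most half of the entries of each row and column are below `δ`, then Hall's marriage
theorem yields a transversal all of whose entries are at least `δ`. -/
theorem exists_perm_forall_le_apply {z : ℕ} {δ : ℝ} (M : Matrix (Fin (2 * z)) (Fin (2 * z)) ℝ)
    (hrow : ∀ i, (Finset.univ.filter fun j => M i j < δ).card ≤ z)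
    (hcol : ∀ j, (Finset.univ.filter fun i => M i j < δ).card ≤ z) :
    ∃ σ : Equiv.Perm (Fin (2 * z)), ∀ j, δ ≤ M (σ j) j := by
  classical
  let t : Fin (2 * z) → Finset (Fin (2 * z)) := fun j => Finset.univ.filter fun i => δ ≤ M i j
  have hdeg : ∀ j, z ≤ (t j).card := by
    intro j
    have h := Finset.card_filter_add_card_filter_not (s := (Finset.univ : Finset (Fin (2 * z))))
      (fun i => M i j < δ)
    simp only [not_lt, Finset.card_univ, Fintype.card_fin] at h
    have := hcol j
    simp only [t]
    omega
  have hall : ∀ s : Finset (Fin (2 * z)), s.card ≤ (s.biUnion t).card := by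
    intro s
    rcases le_or_gt s.card z with hs | hs
    · rcases s.eq_empty_or_nonempty with rfl | ⟨j, hj⟩
      · simp
      · exact (hs.trans (hdeg j)).trans (Finset.card_le_card (Finset.subset_biUnion_of_mem t hj))
    · -- more than `z` columns cannot all have a small entry in the same row
      have huniv : s.biUnion t = Finset.univ := by
        refine Finset.eq_univ_iff_forall.2 fun i => ?_
        by_contra hi
        have hsub : s ⊆ Finset.univ.filter fun j => M i j < δ := by
          intro j hj
          rw [Finset.mem_filter]
          refine ⟨Finset.mem_univ _, lt_of_not_ge fun hge => hi ?_⟩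
          exact Finset.mem_biUnion.2 ⟨j, hj, by simpa [t] using hge⟩
        exact absurd ((Finset.card_le_card hsub).trans (hrow i)) (not_le.2 hs)
      rw [huniv]
      exact Finset.card_le_univ s
  obtain ⟨f, hf, hft⟩ := (Finset.all_card_le_biUnion_card_iff_exists_injective t).1 hall
  refine ⟨Equiv.ofBijective f (Finite.injective_iff_bijective.1 hf), fun j => ?_⟩
  simpa [t] using hft j

/-- Expanding along the first column, at least `z + m` of its entries are at least
`δ`, and the minors inherit the bound `z` on the number of small entries in each line. -/
theorem pow_mul_factorial_le_permanent {z : ℕ} {δ : ℝ} (hδ : 0 ≤ δ) (m : ℕ)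
    (M : Matrix (Fin (2 * z + m)) (Fin (2 * z + m)) ℝ) (hM : ∀ i j, 0 ≤ M i j)
    (hrow : ∀ i, (Finset.univ.filter fun j => M i j < δ).card ≤ z)
    (hcol : ∀ j, (Finset.univ.filter fun i => M i j < δ).card ≤ z) :
    δ ^ (2 * z + m) * m.factorial ≤ M.permanent := by
  induction m with
  | zero =>
    obtain ⟨σ, hσ⟩ := exists_perm_forall_le_apply M hrow hcol
    calc δ ^ (2 * z + 0) * (Nat.factorial 0 : ℝ) = ∏ _j : Fin (2 * z + 0), δ := by simp
      _ ≤ ∏ j, M (σ j) j := Finset.prod_le_prod (fun _ _ => hδ) fun j _ => hσ j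
      _ ≤ M.permanent := Finset.single_le_sum (f := fun σ : Equiv.Perm _ => ∏ j, M (σ j) j)
          (fun σ _ => Finset.prod_nonneg fun j _ => hM _ _) (Finset.mem_univ σ)
  | succ m ih =>
    have hminor : ∀ p : Fin (2 * z + m + 1), δ ^ (2 * z + m) * m.factorial ≤
        (M.submatrix (fun i : Fin (2 * z + m) => Equiv.swap 0 p i.succ) Fin.succ).permanent := by
      intro p
      have hinj : Function.Injective fun i : Fin (2 * z + m) => Equiv.swap 0 p i.succ :=
        (Equiv.injective _).comp (Fin.succ_injective _)
      refine ih _ (fun i j => hM _ _) (fun i => ?_) (fun j => ?_)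
      · refine le_trans (Finset.card_le_card_of_injOn Fin.succ ?_
          (Fin.succ_injective _).injOn) (hrow (Equiv.swap 0 p i.succ))
        intro j hj
        simpa using (Finset.mem_filter.1 hj).2
      · refine le_trans (Finset.card_le_card_of_injOn _ ?_ hinj.injOn) (hcol j.succ)
        intro i hi
        simpa using (Finset.mem_filter.1 hi).2
    have hbig : m + 1 ≤ (Finset.univ.filter fun p : Fin (2 * z + m + 1) => δ ≤ M p 0).card := by
      have h := Finset.card_filter_add_card_filter_not
        (s := (Finset.univ : Finset (Fin (2 * z + m + 1)))) (fun i => M i 0 < δ)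
      simp only [not_lt, Finset.card_univ, Fintype.card_fin] at h
      have : (Finset.univ.filter fun i : Fin (2 * z + m + 1) => M i 0 < δ).card ≤ z := hcol 0
      omega
    have hc : (0 : ℝ) ≤ δ ^ (2 * z + m) * m.factorial := by positivity
    have hexp := Matrix.permanent_succ_column_zero (n := 2 * z + m) M
    refine le_trans ?_ hexp.ge
    calc δ ^ (2 * z + (m + 1)) * ((m + 1).factorial : ℝ)
        = ((m + 1 : ℕ) : ℝ) * (δ * (δ ^ (2 * z + m) * m.factorial)) := by
          rw [Nat.factorial_succ]; push_cast; ring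
      _ ≤ ((Finset.univ.filter fun p : Fin (2 * z + m + 1) => δ ≤ M p 0).card : ℝ) *
            (δ * (δ ^ (2 * z + m) * m.factorial)) := by gcongr
      _ = ∑ _p ∈ Finset.univ.filter (fun p : Fin (2 * z + m + 1) => δ ≤ M p 0),
            δ * (δ ^ (2 * z + m) * m.factorial) := by rw [Finset.sum_const, nsmul_eq_mul]
      _ ≤ ∑ p ∈ Finset.univ.filter (fun p : Fin (2 * z + m + 1) => δ ≤ M p 0), M p 0 *
            (M.submatrix (fun i : Fin (2 * z + m) => Equiv.swap 0 p i.succ) Fin.succ).permanent :=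
          Finset.sum_le_sum fun p hp =>
            mul_le_mul (Finset.mem_filter.1 hp).2 (hminor p) hc (hM _ _)
      _ ≤ _ := Finset.sum_le_sum_of_subset_of_nonneg (Finset.filter_subset _ _)
            fun p _ _ => mul_nonneg (hM _ _) (hc.trans (hminor p))

theorem mul_log_sub_le_log_factorial (m : ℕ) :
    m * Real.log m - m ≤ Real.log m.factorial := by
  rcases m.eq_zero_or_pos with rfl | hm
  · simp
  have hm' : (0 : ℝ) < m := by exact_mod_cast hm
  have h := Real.log_le_log (by positivity) (Real.pow_div_factorial_le_exp (m : ℝ) hm'.le m)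
  rw [Real.log_exp, Real.log_div (by positivity) (by positivity), Real.log_pow] at h
  linarith

/-- Lower bound for the normalized logarithm of the permanent when each line has at most
`(1 - c) / 2 * k` entries below `δ`. -/
theorem sub_div_log_le_normLogPerm {k z : ℕ} {δ c : ℝ} (hδ : 0 < δ)
    (hc : 0 < c) (hk : 1 < k) (hck : 1 ≤ c * k) (hz : (z : ℝ) ≤ (1 - c) / 2 * k)
    (M : Matrix (Fin k) (Fin k) ℝ) (hM : ∀ i j, 0 ≤ M i j)
    (hrow : ∀ i, (Finset.univ.filter fun j => M i j < δ).card ≤ z)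
    (hcol : ∀ j, (Finset.univ.filter fun i => M i j < δ).card ≤ z) :
    c - (1 - Real.log δ - c * Real.log c) / Real.log k ≤ normLogPerm M := by
  have hk0 : (0 : ℝ) < k := by positivity
  have hlogk : 0 < Real.log k := Real.log_pos (by exact_mod_cast hk)
  have h2z : 2 * z ≤ k := by
    have : (2 * z : ℝ) ≤ k := by nlinarith
    exact_mod_cast this
  obtain ⟨m, rfl⟩ := Nat.exists_eq_add_of_le h2z
  have hm : c * ((2 * z + m : ℕ) : ℝ) ≤ m := by
    push_cast at hz ⊢
    linarith
  have hmk : (m : ℝ) ≤ ((2 * z + m : ℕ) : ℝ) := by exact_mod_cast Nat.le_add_left _ _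
  have hm0 : (0 : ℝ) < m := by linarith
  have hperm := Real.log_le_log (by positivity)
    (pow_mul_factorial_le_permanent hδ.le m M hM hrow hcol)
  rw [Real.log_mul (by positivity) (by positivity), Real.log_pow] at hperm
  have hfac := mul_log_sub_le_log_factorial m
  have hlogm : Real.log c + Real.log ((2 * z + m : ℕ) : ℝ) ≤ Real.log m := by
    rw [← Real.log_mul hc.ne' hk0.ne']
    exact Real.log_le_log (by positivity) hm
  have hlog0 : 0 ≤ Real.log c + Real.log ((2 * z + m : ℕ) : ℝ) := by
    rw [← Real.log_mul hc.ne' hk0.ne']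
    exact Real.log_nonneg hck
  rw [normLogPerm, le_div_iff₀ (by positivity)]
  generalize ((2 * z + m : ℕ) : ℝ) = k at *
  have hmm : c * k * (Real.log c + Real.log k) ≤ m * Real.log m :=
    mul_le_mul hm hlogm hlog0 hm0.le
  have hrw : (c - (1 - Real.log δ - c * Real.log c) / Real.log k) * (k * Real.log k) =
      k * Real.log δ + c * k * (Real.log c + Real.log k) - k := by
    field_simp
    ring
  rw [hrw]
  linarith

/-! ### Almost sure bound on the number of small entries in each line -/

/-- A real random variable that is almost surely positive is below some `δ > 0` with arbitrarily
small probability. -/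
theorem exists_pos_measure_lt_le {Ω' : Type*} [MeasurableSpace Ω'] {P' : Measure Ω'}
    [IsFiniteMeasure P'] {ξ : Ω' → ℝ} (hm : AEMeasurable ξ P') (hξ : ∀ᵐ x ∂P', 0 < ξ x)
    {p : ℝ≥0∞} (hp : 0 < p) : ∃ δ : ℝ, 0 < δ ∧ P' {x | ξ x < δ} ≤ p := by
  let s : ℕ → Set Ω' := fun n => {x | ξ x < 1 / ((n : ℝ) + 1)}
  have hs : ∀ n, NullMeasurableSet (s n) P' := fun n =>
    hm.nullMeasurableSet_preimage (measurableSet_Iio (a := 1 / ((n : ℝ) + 1)))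
  have hanti : Antitone s := fun a b hab x hx =>
    lt_of_lt_of_le (show ξ x < _ from hx) (Nat.one_div_le_one_div hab)
  have hzero : P' (⋂ n, s n) = 0 := by
    refine measure_mono_null (fun x hx => ?_) (ae_iff.1 hξ)
    intro hpos
    obtain ⟨n, hn⟩ := exists_nat_one_div_lt (show 0 < ξ x from hpos)
    exact absurd (Set.mem_iInter.1 hx n) (not_lt.2 hn.le)
  have ht := tendsto_measure_iInter_atTop hs hanti ⟨0, measure_ne_top _ _⟩
  rw [hzero] at ht
  obtain ⟨n, hn⟩ := ((tendsto_order.1 ht).2 p hp).exists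
  exact ⟨1 / ((n : ℝ) + 1), Nat.one_div_pos_of_nat, hn.le⟩

/-- A union bound over the set of indices that are small. -/
theorem measure_lt_card_filter_lt_le {Ω : Type*} [MeasurableSpace Ω] {P : Measure Ω} {n : ℕ}
    {X : Fin n → Ω → ℝ} (hX : iIndepFun X P) {δ : ℝ} {p : ℝ≥0∞} (hp1 : p ≤ 1)
    (hp : ∀ i, P {ω | X i ω < δ} ≤ p) (t : ℝ) :
    P {ω | t < (Finset.univ.filter fun i => X i ω < δ).card} ≤ 2 ^ n * p ^ t := by
  classical
  have hsub : {ω | t < (Finset.univ.filter fun i => X i ω < δ).card} ⊆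
      ⋃ S ∈ Finset.univ.filter (fun S : Finset (Fin n) => t < S.card),
        ⋂ i ∈ S, X i ⁻¹' Set.Iio δ := by
    intro ω hω
    refine Set.mem_biUnion (x := Finset.univ.filter fun i => X i ω < δ) ?_ ?_
    · simpa using hω
    · simp
  calc _ ≤ _ := measure_mono hsub
    _ ≤ ∑ S ∈ Finset.univ.filter (fun S : Finset (Fin n) => t < S.card),
        P (⋂ i ∈ S, X i ⁻¹' Set.Iio δ) := measure_biUnion_finset_le _ _
    _ ≤ ∑ S ∈ Finset.univ.filter (fun S : Finset (Fin n) => t < S.card), p ^ t := by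
        refine Finset.sum_le_sum fun S hS => ?_
        rw [hX.measure_inter_preimage_eq_mul S (fun i _ => measurableSet_Iio)]
        calc _ ≤ ∏ _i ∈ S, p := Finset.prod_le_prod' fun i _ => hp i
          _ = p ^ (S.card : ℝ) := by rw [Finset.prod_const, ENNReal.rpow_natCast]
          _ ≤ p ^ t := ENNReal.rpow_le_rpow_of_exponent_ge hp1 (Finset.mem_filter.1 hS).2.le
    _ = ((Finset.univ.filter (fun S : Finset (Fin n) => t < S.card)).card : ℝ≥0∞) * p ^ t := by
        rw [Finset.sum_const, nsmul_eq_mul]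
    _ ≤ 2 ^ n * p ^ t := by
        gcongr
        calc ((Finset.univ.filter (fun S : Finset (Fin n) => t < S.card)).card : ℝ≥0∞)
            ≤ ((Finset.univ : Finset (Finset (Fin n))).card : ℝ≥0∞) := by
              exact_mod_cast Finset.card_filter_le _ _
          _ = 2 ^ n := by simp

theorem tsum_ne_top_of_le_geometric {u : ℕ → ℝ≥0∞} {C : ℝ≥0∞} (hC : C ≠ ∞)
    (hu : ∀ n, u n ≤ C * 2⁻¹ ^ n) : ∑' n, u n ≠ ∞ := by
  refine ne_top_of_le_ne_top ?_ (ENNReal.tsum_le_tsum hu)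
  rw [ENNReal.tsum_mul_left, ENNReal.tsum_geometric]
  exact ENNReal.mul_ne_top hC (by simp)

theorem natCast_le_two_pow (n : ℕ) : (n : ℝ≥0∞) ≤ 2 ^ n := by
  exact_mod_cast Nat.lt_two_pow_self.le

section Entries

variable {Ω Ω' : Type*} [MeasurableSpace Ω] [MeasurableSpace Ω'] {P : Measure Ω}
  {P' : Measure Ω'} {ξ : Ω' → ℝ} {A : (n : ℕ) → Ω → Matrix (Fin n) (Fin n) ℝ}

/-- For every `β > 0` there is a threshold `δ > 0` such that, almost surely, for large `n` every row
and every column of `A n` has at most `β n` entries below `δ`. -/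
theorem exists_pos_ae_eventually_card_lt_le [IsFiniteMeasure P']
    (hξ : ∀ᵐ x ∂P', 0 < ξ x)
    (hindep : ∀ n : ℕ, iIndepFun (fun (p : Fin n × Fin n) (ω : Ω) => A n ω p.1 p.2) P)
    (hident : ∀ (n : ℕ) (i j : Fin n), IdentDistrib (fun ω : Ω => A n ω i j) ξ P P')
    {β : ℝ} (hβ : 0 < β) :
    ∃ δ : ℝ, 0 < δ ∧ ∀ᵐ ω ∂P, ∀ᶠ n : ℕ in atTop,
      (∀ i, ((Finset.univ.filter fun j => A n ω i j < δ).card : ℝ) ≤ β * n) ∧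
      (∀ j, ((Finset.univ.filter fun i => A n ω i j < δ).card : ℝ) ≤ β * n) := by
  -- `p` is chosen so that `p ^ (β * n) = 8⁻¹ ^ n` beats the `2 * n * 2 ^ n` terms of the union bound
  obtain ⟨p, hpdef⟩ : ∃ p : ℝ≥0∞, p = (8⁻¹ : ℝ≥0∞) ^ β⁻¹ := ⟨_, rfl⟩
  have hp0 : 0 < p := by
    rw [hpdef]
    exact ENNReal.rpow_pos (by simp) (by simp)
  have hp1 : p ≤ 1 := by
    rw [hpdef]
    exact ENNReal.rpow_le_one (by simp) (by positivity)
  have hpow : ∀ n : ℕ, p ^ (β * n) = 8⁻¹ ^ n := by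
    intro n
    rw [hpdef, ← ENNReal.rpow_mul, ← mul_assoc, inv_mul_cancel₀ hβ.ne', one_mul,
      ENNReal.rpow_natCast]
  obtain ⟨δ, hδ, hPδ⟩ := exists_pos_measure_lt_le (hident 1 0 0).aemeasurable_snd hξ hp0
  refine ⟨δ, hδ, ?_⟩
  have hentry : ∀ (n : ℕ) (i j : Fin n), P {ω | A n ω i j < δ} ≤ p := fun n i j =>
    ((hident n i j).measure_mem_eq (measurableSet_Iio (a := δ))).trans_le hPδ
  let R : (n : ℕ) → Fin n → Set Ω := fun n i =>
    {ω | β * n < (Finset.univ.filter fun j => A n ω i j < δ).card}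
  let C : (n : ℕ) → Fin n → Set Ω := fun n j =>
    {ω | β * n < (Finset.univ.filter fun i => A n ω i j < δ).card}
  have hR : ∀ n i, P (R n i) ≤ 2 ^ n * 8⁻¹ ^ n := fun n i => by
    rw [← hpow]
    exact measure_lt_card_filter_lt_le
      ((hindep n).precomp (g := fun j => (i, j)) fun a b h => (Prod.mk.inj h).2) hp1
      (fun j => hentry n i j) _
  have hC : ∀ n j, P (C n j) ≤ 2 ^ n * 8⁻¹ ^ n := fun n j => by
    rw [← hpow]
    exact measure_lt_card_filter_lt_le
      ((hindep n).precomp (g := fun i => (i, j)) fun a b h => (Prod.mk.inj h).1) hp1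
      (fun i => hentry n i j) _
  have hsum : ∀ n, P ((⋃ i, R n i) ∪ ⋃ j, C n j) ≤ 2 * 2⁻¹ ^ n := by
    intro n
    calc _ ≤ P (⋃ i, R n i) + P (⋃ j, C n j) := measure_union_le _ _
      _ ≤ (∑ i, P (R n i)) + ∑ j, P (C n j) :=
        add_le_add (measure_iUnion_fintype_le _ _) (measure_iUnion_fintype_le _ _)
      _ ≤ (∑ _i : Fin n, 2 ^ n * 8⁻¹ ^ n) + ∑ _j : Fin n, 2 ^ n * 8⁻¹ ^ n :=
        add_le_add (Finset.sum_le_sum fun i _ => hR n i) (Finset.sum_le_sum fun j _ => hC n j)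
      _ = 2 * (n * (2 ^ n * 8⁻¹ ^ n)) := by simp [two_mul]
      _ ≤ 2 * (2 ^ n * (2 ^ n * 8⁻¹ ^ n)) := by
        gcongr
        exact natCast_le_two_pow n
      _ = 2 * 2⁻¹ ^ n := by
        rw [← mul_pow, ← mul_pow]
        congr 2
        rw [show (8 : ℝ≥0∞) = 2 * 2 * 2 by norm_num, ENNReal.mul_inv (by simp) (by simp),
          ENNReal.mul_inv (by simp) (by simp)]
        rw [show (2 : ℝ≥0∞) * (2 * (2⁻¹ * 2⁻¹ * 2⁻¹)) = (2 * 2⁻¹) * (2 * 2⁻¹) * 2⁻¹ by ring,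
          ENNReal.mul_inv_cancel (by simp) (by simp)]
        simp
  filter_upwards [ae_eventually_notMem (tsum_ne_top_of_le_geometric (by simp) hsum)] with ω hω
  filter_upwards [hω] with n hn
  simp only [Set.mem_union, Set.mem_iUnion, not_or, not_exists] at hn
  exact ⟨fun i => not_lt.1 (hn.1 i), fun j => not_lt.1 (hn.2 j)⟩

theorem ae_forall_entry_pos (hξ : ∀ᵐ x ∂P', 0 < ξ x)
    (hident : ∀ (n : ℕ) (i j : Fin n), IdentDistrib (fun ω : Ω => A n ω i j) ξ P P') :
    ∀ᵐ ω ∂P, ∀ (n : ℕ) (i j : Fin n), 0 < A n ω i j :=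
  ae_all_iff.2 fun n => ae_all_iff.2 fun i => ae_all_iff.2 fun j =>
    (hident n i j).symm.ae_snd measurableSet_Ioi hξ

/-- Almost surely, for large `n` all the normalized logarithms of permanents are at least a given
`q < 1`. -/
theorem ae_eventually_le_minNormLogPerm [IsFiniteMeasure P']
    (hξ : ∀ᵐ x ∂P', 0 < ξ x)
    (hindep : ∀ n : ℕ, iIndepFun (fun (p : Fin n × Fin n) (ω : Ω) => A n ω p.1 p.2) P)
    (hident : ∀ (n : ℕ) (i j : Fin n), IdentDistrib (fun ω : Ω => A n ω i j) ξ P P')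
    {α : ℝ} (hα : 0 < α) {q : ℝ} (hq : q < 1) :
    ∀ᵐ ω ∂P, ∀ᶠ n : ℕ in atTop, (q : EReal) ≤ minNormLogPerm α (A n ω) := by
  obtain ⟨c, hqc, hc1⟩ := exists_between (max_lt hq one_pos)
  obtain ⟨hqc, hc0⟩ := max_lt_iff.1 hqc
  obtain ⟨δ, hδ, hae⟩ := exists_pos_ae_eventually_card_lt_le hξ hindep hident
    (β := (1 - c) / 2 * α) (mul_pos (by linarith) hα)
  have hαn : Tendsto (fun n : ℕ => α * (n : ℝ)) atTop atTop :=
    tendsto_natCast_atTop_atTop.const_mul_atTop hα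
  have hK := (Real.tendsto_log_atTop.comp hαn).const_div_atTop
    (|1 - Real.log δ - c * Real.log c|)
  filter_upwards [hae, ae_forall_entry_pos hξ hident] with ω hω hpos
  filter_upwards [hω, hK.eventually_le_const (sub_pos.2 hqc), hαn.eventually_gt_atTop 1,
    hαn.eventually_ge_atTop (1 / c)] with n hn hKn hn1 hnc
  refine le_iInf fun k => le_iInf fun hk => le_iInf fun B => le_iInf fun hB => ?_
  obtain ⟨I, J, rfl⟩ := hB
  have hk1 : (1 : ℝ) < k := hn1.trans_le hk.1
  have hlog : 0 < Real.log (α * n) := Real.log_pos hn1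
  have hlogk : Real.log (α * n) ≤ Real.log k := Real.log_le_log (by linarith) hk.1
  have hβ : 0 ≤ (1 - c) / 2 * α * n := by
    have : 0 ≤ (1 - c) / 2 := by linarith
    positivity
  have hmain := sub_div_log_le_normLogPerm (k := k) (z := ⌊(1 - c) / 2 * α * n⌋₊) (δ := δ) (c := c)
    hδ hc0 (by exact_mod_cast hk1)
    (by
      have := hnc.trans hk.1
      rwa [div_le_iff₀' hc0] at this)
    ((Nat.floor_le hβ).trans (by
      rw [mul_assoc]
      exact mul_le_mul_of_nonneg_left hk.1 (by linarith)))
    ((A n ω).submatrix I J) (fun i j => (hpos n _ _).le)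
    (fun i => (Finset.card_le_card_of_injOn J
      (fun j hj => by simpa using (Finset.mem_filter.1 hj).2) J.injective.injOn).trans
      (Nat.le_floor (hn.1 (I i))))
    (fun j => (Finset.card_le_card_of_injOn I
      (fun i hi => by simpa using (Finset.mem_filter.1 hi).2) I.injective.injOn).trans
      (Nat.le_floor (hn.2 (J j))))
  refine EReal.coe_le_coe_iff.2 (le_trans ?_ hmain)
  have h1 : (1 - Real.log δ - c * Real.log c) / Real.log k ≤
      |1 - Real.log δ - c * Real.log c| / Real.log (α * n) :=
    div_le_div₀ (abs_nonneg _) (le_abs_self _) hlog hlogk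
  simp only [Function.comp_apply] at hKn
  linarith

end Entries

/-! ### Upper bound for permanents under a first moment condition -/

theorem lintegral_prod_enorm_of_iIndepFun {Ω ι : Type*} [MeasurableSpace Ω] {P : Measure Ω}
    [Fintype ι] {X : ι → Ω → ℝ} (hX : iIndepFun X P) (hm : ∀ i, AEMeasurable (X i) P) :
    ∫⁻ ω, ∏ i, ‖X i ω‖ₑ ∂P = ∏ i, ∫⁻ ω, ‖X i ω‖ₑ ∂P := by
  have hY : iIndepFun (fun i => (hm i).mk (X i)) P := hX.congr fun i => (hm i).ae_eq_mk
  have hprod := lintegral_prod_eq_prod_lintegral_of_indepFun Finset.univ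
    (fun i ω => ‖(hm i).mk (X i) ω‖ₑ) (hY.comp (fun _ x => ‖x‖ₑ) fun _ => measurable_enorm)
    (fun i => (hm i).measurable_mk.enorm)
  have hall : ∀ᵐ ω ∂P, ∀ i, X i ω = (hm i).mk (X i) ω := ae_all_iff.2 fun i => (hm i).ae_eq_mk
  calc ∫⁻ ω, ∏ i, ‖X i ω‖ₑ ∂P = ∫⁻ ω, ∏ i, ‖(hm i).mk (X i) ω‖ₑ ∂P :=
        lintegral_congr_ae (hall.mono fun ω hω => by simp only [hω])
    _ = ∏ i, ∫⁻ ω, ‖(hm i).mk (X i) ω‖ₑ ∂P := hprod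
    _ = ∏ i, ∫⁻ ω, ‖X i ω‖ₑ ∂P := Finset.prod_congr rfl fun i _ =>
        lintegral_congr_ae ((hm i).ae_eq_mk.mono fun ω hω => by simp only [hω])

/-- Markov's inequality for the permanent: its expectation is at most `k! M ^ k`, where `M` is the
first absolute moment of the entries. -/
theorem measure_factorial_mul_pow_le_permanent_le {Ω : Type*} [MeasurableSpace Ω] {P : Measure Ω}
    {k : ℕ} {B : Ω → Matrix (Fin k) (Fin k) ℝ}
    (hB : iIndepFun (fun (p : Fin k × Fin k) ω => B ω p.1 p.2) P)
    (hm : ∀ i j, AEMeasurable (fun ω => B ω i j) P) {M r D : ℝ≥0∞}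
    (hM : ∀ i j, ∫⁻ ω, ‖B ω i j‖ₑ ∂P = M) (hMD : M ≤ r * D) (hD0 : D ≠ 0) (hD : D ≠ ∞) :
    P {ω | k.factorial * D ^ k ≤ ‖(B ω).permanent‖ₑ} ≤ r ^ k := by
  have hterm : ∀ σ : Equiv.Perm (Fin k), AEMeasurable (fun ω => ∏ i, ‖B ω (σ i) i‖ₑ) P :=
    fun σ => Finset.aemeasurable_fun_prod _ fun i _ => (hm _ _).enorm
  have hmean : ∫⁻ ω, ∑ σ : Equiv.Perm (Fin k), ∏ i, ‖B ω (σ i) i‖ₑ ∂P = k.factorial * M ^ k := by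
    rw [lintegral_finsetSum' _ fun σ _ => hterm σ]
    have : ∀ σ : Equiv.Perm (Fin k), ∫⁻ ω, ∏ i, ‖B ω (σ i) i‖ₑ ∂P = M ^ k := fun σ => by
      rw [lintegral_prod_enorm_of_iIndepFun
        (hB.precomp (g := fun i => (σ i, i)) fun a b h => (Prod.mk.inj h).2) fun i => hm _ _]
      simp [hM]
    simp [this, Fintype.card_perm]
  have hmarkov := mul_meas_ge_le_lintegral₀
    (Finset.aemeasurable_fun_sum Finset.univ fun σ _ => hterm σ) (k.factorial * D ^ k)
  rw [hmean] at hmarkov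
  have hsub : {ω | k.factorial * D ^ k ≤ ‖(B ω).permanent‖ₑ} ⊆
      {ω | k.factorial * D ^ k ≤ ∑ σ : Equiv.Perm (Fin k), ∏ i, ‖B ω (σ i) i‖ₑ} := by
    intro ω hω
    refine le_trans (show _ ≤ ‖(B ω).permanent‖ₑ from hω) ((enorm_sum_le _ _).trans_eq ?_)
    refine Finset.sum_congr rfl fun σ _ => ?_
    simp only [enorm_eq_nnnorm, nnnorm_prod, ENNReal.ofNNReal_finsetProd]
  have hfac0 : (k.factorial : ℝ≥0∞) * D ^ k ≠ 0 :=
    mul_ne_zero (by exact_mod_cast k.factorial_ne_zero) (pow_ne_zero _ hD0)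
  have hfac : (k.factorial : ℝ≥0∞) * D ^ k ≠ ∞ :=
    ENNReal.mul_ne_top (ENNReal.natCast_ne_top _) (ENNReal.pow_ne_top hD)
  refine (ENNReal.mul_le_mul_iff_right hfac0 hfac).1 ?_
  calc _ ≤ _ := mul_le_mul_right (measure_mono hsub) _
    _ ≤ _ := hmarkov
    _ ≤ k.factorial * (r * D) ^ k := by gcongr
    _ = _ := by rw [mul_pow]; ring

theorem natCard_fin_orderEmbedding_le (k n : ℕ) : Nat.card (Fin k ↪o Fin n) ≤ 2 ^ n := by
  have hinj : Function.Injective fun I : Fin k ↪o Fin n => Finset.univ.map I.toEmbedding := by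
    intro I J h
    have hrange : Set.range I = Set.range J := by
      simpa using congrArg (fun s : Finset (Fin n) => (s : Set (Fin n))) h
    exact OrderEmbedding.range_inj.1 hrange
  simpa using Nat.card_le_card_of_injective _ hinj

theorem normLogPerm_le_one_add {k : ℕ} {D : ℝ} (hk : 1 < k) (hD : 0 < D)
    {B : Matrix (Fin k) (Fin k) ℝ} (hpos : 0 < B.permanent)
    (hB : B.permanent ≤ k.factorial * D ^ k) :
    normLogPerm B ≤ 1 + Real.log D / Real.log k := by
  have hk0 : (0 : ℝ) < k := by positivity
  have hlogk : 0 < Real.log k := Real.log_pos (by exact_mod_cast hk)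
  have h1 := Real.log_le_log hpos hB
  have h2 : Real.log k.factorial ≤ k * Real.log k := by
    rw [← Real.log_pow]
    exact Real.log_le_log (by positivity) (by exact_mod_cast Nat.factorial_le_pow k)
  rw [Real.log_mul (by positivity) (by positivity), Real.log_pow] at h1
  have hrw : (1 + Real.log D / Real.log k) * (k * Real.log k) =
      k * Real.log k + k * Real.log D := by
    field_simp
  rw [normLogPerm, div_le_iff₀ (by positivity), hrw]
  linarith

theorem permanent_pos {k : ℕ} {B : Matrix (Fin k) (Fin k) ℝ} (hB : ∀ i j, 0 < B i j) :
    0 < B.permanent :=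
  Finset.sum_pos (fun _ _ => Finset.prod_pos fun _ _ => hB _ _) Finset.univ_nonempty

section Entries

variable {Ω Ω' : Type*} [MeasurableSpace Ω] [MeasurableSpace Ω'] {P : Measure Ω}
  {P' : Measure Ω'} {ξ : Ω' → ℝ} {A : (n : ℕ) → Ω → Matrix (Fin n) (Fin n) ℝ}

/-- If `ξ` has finite mean, there is a constant `D` such that, almost surely, for large `n` all
`k × k` submatrices with `k ≥ α n` have permanent at most `k! D ^ k`. -/
theorem exists_pos_ae_eventually_permanent_lt
    (hindep : ∀ n : ℕ, iIndepFun (fun (p : Fin n × Fin n) (ω : Ω) => A n ω p.1 p.2) P)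
    (hident : ∀ (n : ℕ) (i j : Fin n), IdentDistrib (fun ω : Ω => A n ω i j) ξ P P')
    {α : ℝ} (hα : 0 < α) (hint : Integrable ξ P') :
    ∃ D : ℝ, 0 < D ∧ ∀ᵐ ω ∂P, ∀ᶠ n : ℕ in atTop, ∀ k : ℕ, α * n ≤ k → k ≤ n →
      ∀ I J : Fin k ↪o Fin n, ((A n ω).submatrix I J).permanent < k.factorial * D ^ k := by
  -- `r` is chosen so that `r ^ (α * n) = 16⁻¹ ^ n` beats the `(n + 1) * 4 ^ n` choices of `k, I, J`
  obtain ⟨r, hrdef⟩ : ∃ r : ℝ≥0∞, r = (16⁻¹ : ℝ≥0∞) ^ α⁻¹ := ⟨_, rfl⟩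
  have hr0 : r ≠ 0 := by
    rw [hrdef]
    exact (ENNReal.rpow_pos (by simp) (by simp)).ne'
  have hr1 : r ≤ 1 := by
    rw [hrdef]
    exact ENNReal.rpow_le_one (by simp) (by positivity)
  have hpow : ∀ n : ℕ, r ^ (α * n) = 16⁻¹ ^ n := by
    intro n
    rw [hrdef, ← ENNReal.rpow_mul, ← mul_assoc, inv_mul_cancel₀ hα.ne', one_mul,
      ENNReal.rpow_natCast]
  obtain ⟨M, hM⟩ : ∃ M : ℝ≥0∞, M = ∫⁻ x, ‖ξ x‖ₑ ∂P' := ⟨_, rfl⟩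
  have hMtop : M ≠ ∞ := by
    rw [hM]
    exact hint.hasFiniteIntegral.ne
  have hr_top : r ≠ ∞ := ne_top_of_le_ne_top (by simp) hr1
  obtain ⟨D, hDdef⟩ : ∃ D : ℝ≥0∞, D = (M + 1) / r := ⟨_, rfl⟩
  have hD0 : D ≠ 0 := by
    rw [hDdef]
    exact ENNReal.div_ne_zero.2 ⟨by simp, hr_top⟩
  have hDtop : D ≠ ∞ := by
    rw [hDdef]
    exact ENNReal.div_ne_top (by simp [hMtop]) hr0
  have hMD : M ≤ r * D := by
    rw [hDdef, ENNReal.mul_div_cancel hr0 hr_top]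
    exact le_self_add
  refine ⟨D.toReal, ENNReal.toReal_pos hD0 hDtop, ?_⟩
  let E : (n k : ℕ) → (Fin k ↪o Fin n) × (Fin k ↪o Fin n) → Set Ω := fun n k IJ =>
    {ω | k.factorial * D ^ k ≤ ‖((A n ω).submatrix IJ.1 IJ.2).permanent‖ₑ}
  have hE : ∀ (n k : ℕ) IJ, α * n ≤ k → P (E n k IJ) ≤ 16⁻¹ ^ n := by
    intro n k IJ hk
    calc P (E n k IJ) ≤ r ^ k := measure_factorial_mul_pow_le_permanent_le
          ((hindep n).precomp (g := fun p : Fin k × Fin k => (IJ.1 p.1, IJ.2 p.2))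
            (IJ.1.injective.prodMap IJ.2.injective))
          (fun i j => (hident n _ _).aemeasurable_fst)
          (fun i j => ((hident n (IJ.1 i) (IJ.2 j)).comp measurable_enorm).lintegral_eq.trans
            hM.symm) hMD hD0 hDtop
      _ = r ^ (k : ℝ) := (ENNReal.rpow_natCast _ _).symm
      _ ≤ r ^ (α * n) := ENNReal.rpow_le_rpow_of_exponent_ge hr1 hk
      _ = _ := hpow n
  have hsum : ∀ n : ℕ, P (⋃ k ∈ (Finset.range (n + 1)).filter (fun k : ℕ => α * n ≤ k),
      ⋃ IJ, E n k IJ) ≤ 2 * 2⁻¹ ^ n := by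
    intro n
    have hunion : ∀ k ∈ (Finset.range (n + 1)).filter (fun k : ℕ => α * n ≤ k),
        P (⋃ IJ, E n k IJ) ≤ 4 ^ n * 16⁻¹ ^ n := by
      intro k hk
      let _ : Fintype ((Fin k ↪o Fin n) × (Fin k ↪o Fin n)) := Fintype.ofFinite _
      calc _ ≤ ∑ IJ, P (E n k IJ) := measure_iUnion_fintype_le _ _
        _ ≤ ∑ _IJ : (Fin k ↪o Fin n) × (Fin k ↪o Fin n), 16⁻¹ ^ n :=
          Finset.sum_le_sum fun IJ _ => hE n k IJ (Finset.mem_filter.1 hk).2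
        _ = (Nat.card ((Fin k ↪o Fin n) × (Fin k ↪o Fin n)) : ℝ≥0∞) * 16⁻¹ ^ n := by
          simp [Nat.card_eq_fintype_card]
        _ ≤ 4 ^ n * 16⁻¹ ^ n := by
          gcongr
          have h := natCard_fin_orderEmbedding_le k n
          have : Nat.card ((Fin k ↪o Fin n) × (Fin k ↪o Fin n)) ≤ 4 ^ n := by
            rw [Nat.card_prod, show 4 = 2 * 2 from rfl, mul_pow]
            exact Nat.mul_le_mul h h
          exact_mod_cast this
    calc _ ≤ _ := measure_biUnion_finset_le _ _
      _ ≤ ∑ _k ∈ (Finset.range (n + 1)).filter (fun k : ℕ => α * n ≤ k),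
          (4 ^ n * 16⁻¹ ^ n : ℝ≥0∞) := Finset.sum_le_sum hunion
      _ ≤ ∑ _k ∈ Finset.range (n + 1), (4 ^ n * 16⁻¹ ^ n : ℝ≥0∞) :=
        Finset.sum_le_sum_of_subset (Finset.filter_subset _ _)
      _ = ((n + 1 : ℕ) : ℝ≥0∞) * (4 ^ n * 16⁻¹ ^ n) := by
        rw [Finset.sum_const, Finset.card_range, nsmul_eq_mul]
      _ ≤ 2 ^ (n + 1) * (4 ^ n * 16⁻¹ ^ n) := by
        gcongr
        exact natCast_le_two_pow (n + 1)
      _ = 2 * 2⁻¹ ^ n := by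
        rw [pow_succ', mul_assoc, ← mul_pow, ← mul_pow]
        congr 2
        rw [show (16 : ℝ≥0∞) = 2 * 4 * 2 by norm_num, ENNReal.mul_inv (by simp) (by simp),
          ENNReal.mul_inv (by simp) (by simp),
          show (2 : ℝ≥0∞) * (4 * (2⁻¹ * 4⁻¹ * 2⁻¹)) = (2 * 2⁻¹) * (4 * 4⁻¹) * 2⁻¹ by ring,
          ENNReal.mul_inv_cancel (by simp) (by simp), ENNReal.mul_inv_cancel (by simp) (by simp)]
        simp
  filter_upwards [ae_eventually_notMem (tsum_ne_top_of_le_geometric (by simp) hsum)] with ω hω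
  filter_upwards [hω] with n hn k hk hkn I J
  simp only [Set.mem_iUnion, not_exists] at hn
  have hlt : ‖((A n ω).submatrix I J).permanent‖ₑ < k.factorial * D ^ k :=
    lt_of_not_ge (hn k (by simp [hk, Nat.lt_succ_of_le hkn]) (I, J))
  refine (le_abs_self _).trans_lt ?_
  have htop : (k.factorial : ℝ≥0∞) * D ^ k ≠ ∞ :=
    ENNReal.mul_ne_top (ENNReal.natCast_ne_top _) (ENNReal.pow_ne_top hDtop)
  have := (ENNReal.toReal_lt_toReal (by simp) htop).2 hlt
  simpa using this

/-- If `ξ` has finite mean then, almost surely, for large `n` all the normalized logarithms of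
permanents are at most a given `q > 1`. -/
theorem ae_eventually_maxNormLogPerm_le (hξ : ∀ᵐ x ∂P', 0 < ξ x)
    (hindep : ∀ n : ℕ, iIndepFun (fun (p : Fin n × Fin n) (ω : Ω) => A n ω p.1 p.2) P)
    (hident : ∀ (n : ℕ) (i j : Fin n), IdentDistrib (fun ω : Ω => A n ω i j) ξ P P')
    {α : ℝ} (hα : 0 < α) (hint : Integrable ξ P') {q : ℝ} (hq : 1 < q) :
    ∀ᵐ ω ∂P, ∀ᶠ n : ℕ in atTop, maxNormLogPerm α (A n ω) ≤ (q : EReal) := by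
  obtain ⟨D, hD, hae⟩ := exists_pos_ae_eventually_permanent_lt hindep hident hα hint
  have hαn : Tendsto (fun n : ℕ => α * (n : ℝ)) atTop atTop :=
    tendsto_natCast_atTop_atTop.const_mul_atTop hα
  have hK := (Real.tendsto_log_atTop.comp hαn).const_div_atTop |Real.log D|
  filter_upwards [hae, ae_forall_entry_pos hξ hident] with ω hω hpos
  filter_upwards [hω, hK.eventually_le_const (sub_pos.2 hq), hαn.eventually_gt_atTop 1]
    with n hn hKn hn1
  refine iSup_le fun k => iSup_le fun hk => iSup_le fun B => iSup_le fun hB => ?_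
  obtain ⟨I, J, rfl⟩ := hB
  have hk1 : (1 : ℝ) < k := hn1.trans_le hk.1
  have hlog : 0 < Real.log (α * n) := Real.log_pos hn1
  have hlogk : Real.log (α * n) ≤ Real.log k := Real.log_le_log (by linarith) hk.1
  have hmain := normLogPerm_le_one_add (by exact_mod_cast hk1) hD
    (permanent_pos fun i j => hpos n (I i) (J j)) (hn k hk.1 hk.2 I J).le
  refine EReal.coe_le_coe_iff.2 (hmain.trans ?_)
  have h1 : Real.log D / Real.log k ≤ |Real.log D| / Real.log (α * n) :=
    div_le_div₀ (abs_nonneg _) (le_abs_self _) hlog hlogk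
  simp only [Function.comp_apply] at hKn
  linarith

end Entries

theorem minNormLogPerm_le_maxNormLogPerm {α : ℝ} (hα : α ≤ 1) {n : ℕ}
    (A : Matrix (Fin n) (Fin n) ℝ) : minNormLogPerm α A ≤ maxNormLogPerm α A := by
  have hn : α * (n : ℝ) ≤ (n : ℝ) ∧ n ≤ n :=
    ⟨mul_le_of_le_one_left (Nat.cast_nonneg n) hα, le_rfl⟩
  have hA : A ∈ squareSubmatrices A n := ⟨RelEmbedding.refl _, RelEmbedding.refl _, rfl⟩
  exact (iInf₂_le_of_le n hn (iInf₂_le A hA)).trans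
    (le_iSup₂_of_le n hn (le_iSup₂ (f := fun B (_ : B ∈ squareSubmatrices A n) =>
      ((normLogPerm B : ℝ) : EReal)) A hA))

/-! ### Almost sure limits -/

theorem theorem2 {Ω Ω' : Type*} [MeasurableSpace Ω] [MeasurableSpace Ω']
    (P : Measure Ω) [IsProbabilityMeasure P] (P' : Measure Ω') [IsProbabilityMeasure P']
    (ξ : Ω' → ℝ) (hξ : ∀ᵐ x ∂P', 0 < ξ x)
    (A : (n : ℕ) → Ω → Matrix (Fin n) (Fin n) ℝ)
    (hindep : ∀ n : ℕ, iIndepFun (fun (p : Fin n × Fin n) (ω : Ω) => A n ω p.1 p.2) P)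
    (hident : ∀ (n : ℕ) (i j : Fin n), IdentDistrib (fun ω : Ω => A n ω i j) ξ P P')
    (α : ℝ) (hα0 : 0 < α) (hα1 : α < 1) :
    (∀ᵐ ω ∂P, 1 ≤ liminf (fun n : ℕ => minNormLogPerm α (A n ω)) atTop) ∧
    (Integrable ξ P' →
      ∀ᵐ ω ∂P, limsup (fun n : ℕ => maxNormLogPerm α (A n ω)) atTop = 1) := by
  have hlower : ∀ᵐ ω ∂P, 1 ≤ liminf (fun n : ℕ => minNormLogPerm α (A n ω)) atTop := by
    have hall : ∀ᵐ ω ∂P, ∀ q : ℚ, (q : ℝ) < 1 →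
        ∀ᶠ n : ℕ in atTop, ((q : ℝ) : EReal) ≤ minNormLogPerm α (A n ω) :=
      ae_all_iff.2 fun q => eventually_imp_distrib_left.2 fun hq =>
        ae_eventually_le_minNormLogPerm hξ hindep hident hα0 hq
    filter_upwards [hall] with ω hω
    refine le_of_forall_lt fun b hb => ?_
    obtain ⟨q, hbq, hq⟩ := EReal.lt_iff_exists_rat_btwn.1 hb
    exact hbq.trans_le (le_liminf_of_le (h := hω q (by exact_mod_cast hq)))
  refine ⟨hlower, fun hint => ?_⟩
  have hall : ∀ᵐ ω ∂P, ∀ q : ℚ, 1 < (q : ℝ) →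
      ∀ᶠ n : ℕ in atTop, maxNormLogPerm α (A n ω) ≤ ((q : ℝ) : EReal) :=
    ae_all_iff.2 fun q => eventually_imp_distrib_left.2 fun hq =>
      ae_eventually_maxNormLogPerm_le hξ hindep hident hα0 hint hq
  filter_upwards [hlower, hall] with ω hlow hω
  refine le_antisymm (le_of_forall_gt fun b hb => ?_) ?_
  · obtain ⟨q, hq, hqb⟩ := EReal.lt_iff_exists_rat_btwn.1 hb
    exact (limsup_le_of_le (h := hω q (by exact_mod_cast hq))).trans_lt hqb
  · exact (hlow.trans (liminf_le_liminf (Eventually.of_forall fun n =>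
      minNormLogPerm_le_maxNormLogPerm hα1.le (A n ω)))).trans liminf_le_limsup
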